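/- Let $K$ be an algebraically closed field of characteristic zero and let $f\in K[x_1,x_2,x_3]$ be an irreducible polynomial such that the surface $V=\{f=0\}\subset K^3$ is not cylindrical (that is, $V$ is not a union of lines parallel to one fixed direction). Suppose that $V$ is a translational surface: there are non-constant $P_1\in K(t_1)^3$ and $P_2\in K(t_2)^3$ such that $P_1(t_1)+P_2(t_2)$ is a rational parametrization of $V$ (the values of the sum are Zariski dense in $V$), where $P_1$ and $P_2$ are taken to be proper (each is birational onto the Zariski closure of its image). Let $t_2^0\in K$ be any point at which $P_2$ is defined and such that $(a_1,a_2,a_3):=P_2'(t_2^0)\neq(0,0,0)$, and put $$g:=a_1\frac{\partial f}{\partial x_1}+a_2\frac{\partial f}{\partial x_2}+a_3\frac{\partial f}{\partial x_3}.$$ Then the equations $f=g=0$ define a (possibly reducible) space curve in $K^3$, i.e. a nonempty algebraic set all of whose irreducible components have dimension one, and $\overline P_1(t_1):=P_1(t_1)+P_2(t_2^0)$ is a proper rational parametrization of a space curve defined by these equations, i.e. of an irreducible component of $\{f=g=0\}$. In addition, with $\overline P_2(t_2):=P_2(t_2)-P_2(t_2^0)$, which is again proper, $\overline P_1(t_1)+\overline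 P_2(t_2)$ is a rational parametrization of $V$. -/

import Mathlib

noncomputable section

namespace Translational

open MvPolynomial

variable {K : Type*} [Field K]

/-- Polynomials in the coordinates `x 0, x 1, x 2` of the affine space `K³`. -/
abbrev Poly3 (K : Type*) [Field K] := MvPolynomial (Fin 3) K

/-- Triples of rational functions in one variable. -/
abbrev RatTriple (K : Type*) [Field K] := Fin 3 → RatFunc K

/-! ### Zariski geometry of affine space -/

/-- The algebraic set defined by a set of equations. -/
def algSet (S : Set (Poly3 K)) : Set (Fin 3 → K) :=
  {x | ∀ p ∈ S, eval x p = 0}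

/-- The Zariski closure of a set of points. -/
def zariskiClosure (S : Set (Fin 3 → K)) : Set (Fin 3 → K) :=
  zeroLocus K (vanishingIdeal K S)

/-- Irreducible Zariski closed sets (affine varieties): the vanishing ideal is prime. -/
def IsVariety (C : Set (Fin 3 → K)) : Prop :=
  zariskiClosure C = C ∧ (vanishingIdeal K C).IsPrime

/-- The irreducible components of `Z`: the maximal irreducible closed subsets. -/
def IsComponent (C Z : Set (Fin 3 → K)) : Prop :=
  Maximal (fun D : Set (Fin 3 → K) => IsVariety D ∧ D ⊆ Z) C

/-- The dimension of an algebraic set: the Krull dimension of its coordinate ring. -/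
def dimension (C : Set (Fin 3 → K)) : WithBot ℕ∞ :=
  ringKrullDim (Poly3 K ⧸ vanishingIdeal K C)

/-- A (possibly reducible) space curve: a nonempty algebraic set, all of whose irreducible
components have dimension one. -/
def IsSpaceCurve (Z : Set (Fin 3 → K)) : Prop :=
  Z.Nonempty ∧ zariskiClosure Z = Z ∧ ∀ C, IsComponent C Z → dimension C = 1

/-- `V` is cylindrical: it is a union of lines parallel to one fixed direction `a ≠ 0`. -/
def IsCylindrical (V : Set (Fin 3 → K)) : Prop :=
  ∃ a : Fin 3 → K, a ≠ 0 ∧ ∀ x ∈ V, ∀ c : K, x + c • a ∈ V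

/-- The directional derivative `∇f · a = a₁ f_{x₁} + a₂ f_{x₂} + a₃ f_{x₃}`. -/
def gradDot (f : Poly3 K) (a : Fin 3 → K) : Poly3 K :=
  ∑ i, C (a i) * pderiv i f

/-! ### Rational functions of one variable -/

/-- `P` is defined at `t`: the reduced denominators of its entries do not vanish there. -/
def DefinedAt (P : RatTriple K) (t : K) : Prop :=
  ∀ i, (P i).denom.eval t ≠ 0

/-- The value `P(t)`. It is meaningful only where `P` is defined. -/
def valueAt (P : RatTriple K) (t : K) : Fin 3 → K :=
  fun i => (P i).eval (RingHom.id K) t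

/-- The derivative of a rational function (quotient rule). -/
def ratDeriv (r : RatFunc K) : RatFunc K :=
  (algebraMap (Polynomial K) (RatFunc K)
      (Polynomial.derivative r.num * r.denom - r.num * Polynomial.derivative r.denom)) /
    (algebraMap (Polynomial K) (RatFunc K) (r.denom ^ 2))

/-- The derivative `P'` of a triple of rational functions, entry by entry. -/
def derivTriple (P : RatTriple K) : RatTriple K :=
  fun i => ratDeriv (P i)

/-- A point of `K³`, as a triple of constant rational functions. -/
def constTriple (v : Fin 3 → K) : RatTriple K :=
  fun i => RatFunc.C (v i)

/-- `P` is not constant, that is, `P ∉ K³`. -/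
def Nonconstant (P : RatTriple K) : Prop :=
  ∀ v : Fin 3 → K, P ≠ constTriple v

/-! ### Parametrizations -/

/-- `P(t)` is a rational parametrization of the curve `C`: it is not constant, and its values
form a Zariski dense subset of `C`, which is Zariski closed. -/
def ParametrizesCurve (P : RatTriple K) (C : Set (Fin 3 → K)) : Prop :=
  Nonconstant P ∧ zariskiClosure {x | ∃ t, DefinedAt P t ∧ x = valueAt P t} = C

/-- `P` is proper: it is birational onto its curve, that is, some rational function `A / B`,
whose denominator does not vanish identically on the curve, satisfies
`A(P(t)) / B(P(t)) = t`. -/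
def Proper (P : RatTriple K) : Prop :=
  ∃ A B : Poly3 K, aeval P B ≠ 0 ∧ aeval P A / aeval P B = (RatFunc.X : RatFunc K)

/-- `P₁(t₁) + P₂(t₂)`, with `P₁` and `P₂` not constant, is a rational parametrization of `V`:
its values form a Zariski dense subset of `V`, which is Zariski closed. The sum is defined at
`(s, t)` exactly when `P₁` is defined at `s` and `P₂` is defined at `t`. -/
def SumParametrizes (P₁ P₂ : RatTriple K) (V : Set (Fin 3 → K)) : Prop :=
  Nonconstant P₁ ∧ Nonconstant P₂ ∧
    zariskiClosure {x | ∃ s t, DefinedAt P₁ s ∧ DefinedAt P₂ t ∧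
      x = valueAt P₁ s + valueAt P₂ t} = V

end Translational

end

noncomputable section

namespace Translational

open MvPolynomial

variable {K : Type*} [Field K]

/-! ### The directional derivative -/

/-! Since `g` has smaller degree than `f`, `f ∣ g` would force `g = 0`; then `f` would be constant
on lines of direction `a` and `V` cylindrical (`not_dvd_gradDot`). So primes containing `f` and `g`
have quotients of dimension at most one. A component of `{f = g = 0}` is not a point: its ideal is
minimal over `(f, g)`, hence of height at most 2 by Krull, whereas maximal ideals have height 3.

Differentiating `f(P₁(s) + P₂(t)) = 0` in `t` at `t₀` puts the values of `P₁ + P₂(t₀)` on `{f = g =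
0}` (`SumParametrizes.values_subset`). Their vanishing ideal is the kernel of a map into `K(t)`:
prime, and not maximal because `P₁` is not constant. For dimension reasons their closure is then a
component. Properness and the new parametrization of `V` follow by translation. -/

lemma gradDot_add (p q : Poly3 K) (a : Fin 3 → K) :
    gradDot (p + q) a = gradDot p a + gradDot q a := by
  simp [gradDot, mul_add, Finset.sum_add_distrib]

lemma gradDot_mul (p q : Poly3 K) (a : Fin 3 → K) :
    gradDot (p * q) a = p * gradDot q a + gradDot p a * q := by
  simp only [gradDot, Derivation.leibniz, smul_eq_mul, Finset.mul_sum, Finset.sum_mul,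
    ← Finset.sum_add_distrib]
  exact Finset.sum_congr rfl fun i _ => by ring

lemma gradDot_C (c : K) (a : Fin 3 → K) : gradDot (C c) a = 0 := by
  simp [gradDot]

lemma gradDot_X (i : Fin 3) (a : Fin 3 → K) : gradDot (X i) a = C (a i) := by
  simp [gradDot, pderiv_X, Pi.single_apply]

/-- First order Taylor expansion over the dual numbers. -/
lemma aeval_dual (p : Poly3 K) (x a : Fin 3 → K) :
    aeval (fun i => (TrivSqZeroExt.inl (x i) + TrivSqZeroExt.inr (a i) : DualNumber K)) p =
      TrivSqZeroExt.inl (eval x p) + TrivSqZeroExt.inr (eval x (gradDot p a)) := by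
  induction p using MvPolynomial.induction_on with
  | C c => ext <;> simp [gradDot_C, TrivSqZeroExt.algebraMap_eq_inl]
  | add p q hp hq => rw [map_add, hp, hq, gradDot_add]; ext <;> simp
  | mul_X p i hp =>
    rw [map_mul, hp, aeval_X, gradDot_mul, gradDot_X]; ext <;> simp

/-- The chain rule along a line. -/
lemma derivative_aeval_line (p : Poly3 K) (x a : Fin 3 → K) :
    Polynomial.derivative
        (aeval (fun i => Polynomial.C (x i) + Polynomial.X * Polynomial.C (a i)) p) =
      aeval (fun i => Polynomial.C (x i) + Polynomial.X * Polynomial.C (a i)) (gradDot p a) := by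
  induction p using MvPolynomial.induction_on with
  | C c => simp [gradDot_C, Polynomial.algebraMap_eq]
  | add p q hp hq => rw [map_add, gradDot_add, map_add, map_add, hp, hq]
  | mul_X p i hp =>
    rw [map_mul, aeval_X, gradDot_mul, gradDot_X, Polynomial.derivative_mul, hp]
    simp [Polynomial.algebraMap_eq]; ring

/-- Restricted to a line of direction `a`, `f` is a one-variable polynomial with zero derivative,
hence constant in characteristic zero. -/
lemma eval_add_smul_of_gradDot_eq_zero [CharZero K] {f : Poly3 K} {a : Fin 3 → K}
    (h : gradDot f a = 0) (x : Fin 3 → K) (c : K) : eval (x + c • a) f = eval x f := by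
  set q := aeval (fun i => Polynomial.C (x i) + Polynomial.X * Polynomial.C (a i)) f with hq
  have hd : Polynomial.derivative q = 0 := by rw [hq, derivative_aeval_line, h, map_zero]
  have key (t : K) : q.eval t = eval (x + t • a) f := by
    rw [hq, ← Polynomial.coe_evalRingHom, aeval_def, eval₂_eq_eval_map, eval_map]
    rw [← eval₂_id, Polynomial.coe_evalRingHom, ← Polynomial.coe_evalRingHom, hom_eval₂]
    congr 1
    · ext; simp
    · ext i; simp [mul_comm t]
  have h0 := key 0
  rw [zero_smul, add_zero] at h0
  rw [← key, ← h0, Polynomial.eq_C_of_derivative_eq_zero hd]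
  simp

lemma totalDegree_pderiv_le (i : Fin 3) (f : Poly3 K) :
    (pderiv i f).totalDegree ≤ f.totalDegree - 1 := by
  conv_lhs => rw [f.as_sum, map_sum]
  refine totalDegree_finsetSum_le fun s hs => ?_
  rw [pderiv_monomial]
  by_cases hsi : s i = 0
  · simp [hsi]
  refine (totalDegree_monomial_le _ _).trans ?_
  have h1 := le_totalDegree hs
  have h2 : (s - Finsupp.single i 1) + Finsupp.single i 1 = s :=
    tsub_add_cancel_of_le (by simpa [Nat.one_le_iff_ne_zero] using hsi)
  have h3 : ((s - Finsupp.single i 1).sum fun _ e => e) + 1 = s.sum fun _ e => e := by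
    conv_rhs => rw [← h2, Finsupp.sum_add_index' (by simp) (by simp)]
    simp
  change ((s - Finsupp.single i 1).sum fun _ e => e) ≤ _
  omega

lemma totalDegree_pos_of_irreducible {f : Poly3 K} (hf : Irreducible f) : 0 < f.totalDegree := by
  refine Nat.pos_of_ne_zero fun h => hf.not_isUnit ?_
  rw [totalDegree_eq_zero_iff_eq_C] at h
  have h0 := hf.ne_zero
  rw [h] at h0 ⊢
  exact (isUnit_iff_ne_zero.2 fun hc => h0 (by rw [hc, C_0])).map C

lemma gradDot_eq_zero_of_dvd {f : Poly3 K} (hf : Irreducible f) {a : Fin 3 → K}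
    (h : f ∣ gradDot f a) : gradDot f a = 0 := by
  by_contra h0
  have h1 := totalDegree_le_of_dvd_of_isDomain h h0
  have h2 : (gradDot f a).totalDegree ≤ f.totalDegree - 1 :=
    totalDegree_finsetSum_le fun i _ => (totalDegree_mul _ _).trans <| by
      rw [totalDegree_C, zero_add]; exact totalDegree_pderiv_le i f
  -- Positivity is needed because the subtraction in `h2` is truncated.
  have := totalDegree_pos_of_irreducible hf
  omega

lemma not_dvd_gradDot [CharZero K] {f : Poly3 K} (hf : Irreducible f)
    (hcyl : ¬ IsCylindrical (algSet {f})) {a : Fin 3 → K} (ha : a ≠ 0) : ¬ f ∣ gradDot f a := by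
  refine fun h => hcyl ⟨a, ha, fun x hx c => ?_⟩
  simp only [algSet, Set.mem_singleton_iff, forall_eq, Set.mem_ofPred_eq] at hx ⊢
  rw [eval_add_smul_of_gradDot_eq_zero (gradDot_eq_zero_of_dvd hf h), hx]

/-! ### Heights and dimensions in `K[x₀, x₁, x₂]` -/

/-- Translation by `v`, as an automorphism of the polynomial ring. -/
def translate (v : Fin 3 → K) : Poly3 K ≃ₐ[K] Poly3 K :=
  AlgEquiv.ofAlgHom (aeval fun i => X i + C (v i)) (aeval fun i => X i - C (v i))
    (by ext i; simp) (by ext i; simp)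

lemma translate_apply (v : Fin 3 → K) (p : Poly3 K) :
    translate v p = aeval (fun i => X i + C (v i)) p := rfl

lemma eval_translate (v x : Fin 3 → K) (p : Poly3 K) :
    eval x (translate v p) = eval (x + v) p := by
  rw [translate_apply, ← eval₂_id, ← coe_eval₂Hom, aeval_def, hom_eval₂, ← eval₂_id]
  congr 1
  · ext; simp
  · ext i; simp

lemma ringKrullDim_poly3 : ringKrullDim (Poly3 K) = 3 := by
  rw [MvPolynomial.ringKrullDim_of_isNoetherianRing, ringKrullDim_eq_zero_of_field]
  simp

lemma comap_translate_vanishingIdeal (v x : Fin 3 → K) :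
    (vanishingIdeal K {x}).comap (translate v).toRingEquiv = vanishingIdeal K {x + v} := by
  ext p
  rw [Ideal.mem_comap, mem_vanishingIdeal_singleton_iff, mem_vanishingIdeal_singleton_iff]
  simp only [aeval_eq_eval]
  exact (eval_translate v x p).congr_left

/-- Some maximal ideal attains the Krull dimension 3. By the Nullstellensatz maximal ideals are
points, and translations permute points transitively. -/
lemma height_of_isMaximal [IsAlgClosed K] (m : Ideal (Poly3 K)) (hm : m.IsMaximal) :
    m.height = 3 := by
  have : FiniteRingKrullDim (Poly3 K) := by
    rw [finiteRingKrullDim_iff_ne_bot_and_top, ringKrullDim_poly3]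
    exact ⟨by decide, by decide⟩
  obtain ⟨n, hn, hn3⟩ := Ideal.exists_isMaximal_height (R := Poly3 K)
  rw [ringKrullDim_poly3] at hn3
  obtain ⟨x, rfl⟩ := eq_vanishingIdeal_singleton_of_isMaximal K hm
  obtain ⟨y, rfl⟩ := eq_vanishingIdeal_singleton_of_isMaximal K hn
  have h := RingEquiv.height_comap (translate (y - x)).toRingEquiv (vanishingIdeal K {x})
  rw [comap_translate_vanishingIdeal, add_sub_cancel] at h
  rw [← h]
  exact WithBot.coe_injective hn3

/-- The dimension drops by one modulo `f`, and again modulo `g`, which is a nonzero element of the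
domain `K[x]/(f)`. -/
lemma ringKrullDim_quotient_le_one {f g : Poly3 K} (hf : Irreducible f) (hfg : ¬ f ∣ g)
    {q : Ideal (Poly3 K)} (hfq : f ∈ q) (hgq : g ∈ q) :
    ringKrullDim (Poly3 K ⧸ q) ≤ 1 := by
  have : (Ideal.span {f}).IsPrime := (Ideal.span_singleton_prime hf.ne_zero).2 hf.prime
  have h1 := ringKrullDim_quotient_succ_le_of_nonZeroDivisor
    (mem_nonZeroDivisors_of_ne_zero hf.ne_zero)
  have hle : Ideal.span {f} ≤ q := (Ideal.span_singleton_le_iff_mem _).2 hfq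
  have hg : Ideal.Quotient.mk (Ideal.span {f}) g ≠ 0 := by
    rwa [Ne, Ideal.Quotient.eq_zero_iff_mem, Ideal.mem_span_singleton]
  have h2 := ringKrullDim_succ_le_of_surjective (Ideal.Quotient.factor hle)
    (Ideal.Quotient.factor_surjective hle) (mem_nonZeroDivisors_of_ne_zero hg)
    (by rw [Ideal.Quotient.factor_mk, Ideal.Quotient.eq_zero_iff_mem]; exact hgq)
  rw [ringKrullDim_poly3] at h1
  have h3 : ringKrullDim (Poly3 K ⧸ q) + 1 + 1 ≤ 3 := (add_le_add_left h2 1).trans h1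
  revert h3
  generalize ringKrullDim (Poly3 K ⧸ q) = d
  intro h3
  -- The value `⊥` does occur, for `q = ⊤`.
  induction d using WithBot.recBotCoe with
  | bot => exact bot_le
  | coe d =>
    induction d using ENat.recTopCoe with
    | top => exact absurd h3 (by decide)
    | coe n =>
      have : n + 1 + 1 ≤ 3 := by
        rw [← Nat.cast_le (α := WithBot ℕ∞)]
        push_cast
        exact h3
      have : n ≤ 1 := by omega
      exact_mod_cast this

/-- A prime ideal containing `f` and `g` that is not maximal has a quotient of dimension one. -/
lemma ringKrullDim_quotient_eq_one {f g : Poly3 K} (hf : Irreducible f) (hfg : ¬ f ∣ g)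
    {q : Ideal (Poly3 K)} [q.IsPrime] (hfq : f ∈ q) (hgq : g ∈ q) (hq : ¬ q.IsMaximal) :
    ringKrullDim (Poly3 K ⧸ q) = 1 := by
  refine le_antisymm (ringKrullDim_quotient_le_one hf hfg hfq hgq) ?_
  by_contra h
  have h0 : ringKrullDim (Poly3 K ⧸ q) ≤ (0 : ℕ) := by
    have := not_le.1 h
    rw [← zero_add (1 : WithBot ℕ∞)] at this
    exact_mod_cast ENat.WithBot.lt_add_one_iff.1 this
  rw [← Ring.krullDimLE_iff] at h0
  exact hq (Ideal.Quotient.maximal_of_isField q 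
    (Ring.KrullDimLE.isField_of_isDomain))

/-- In the domain `K[x]/q`, of dimension at most one, nonzero primes are maximal; if `q < p`, the
image of `p` would be one. -/
lemma eq_of_le_of_not_isMaximal {f g : Poly3 K} (hf : Irreducible f) (hfg : ¬ f ∣ g)
    {q p : Ideal (Poly3 K)} [q.IsPrime] [p.IsPrime] (hfq : f ∈ q) (hgq : g ∈ q) (hqp : q ≤ p)
    (hp : ¬ p.IsMaximal) : q = p := by
  refine hqp.eq_of_not_lt fun hlt => hp ?_
  have : Ring.KrullDimLE 1 (Poly3 K ⧸ q) :=
    Ring.krullDimLE_iff.2 (by exact_mod_cast ringKrullDim_quotient_le_one hf hfg hfq hgq)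
  have hpr : (p.map (Ideal.Quotient.mk q)).IsPrime :=
    Ideal.map_isPrime_of_surjective Ideal.Quotient.mk_surjective (by rwa [Ideal.mk_ker])
  have hne : p.map (Ideal.Quotient.mk q) ≠ ⊥ := fun h => hlt.not_ge (by
    rw [Ideal.map_eq_bot_iff_le_ker, Ideal.mk_ker] at h; exact h)
  have hmax := Ring.krullDimLE_one_iff_of_noZeroDivisors.1 this _ hne hpr
  have := Ideal.comap_isMaximal_of_surjective (Ideal.Quotient.mk q)
    Ideal.Quotient.mk_surjective (K := p.map (Ideal.Quotient.mk q))
  rwa [Ideal.comap_map_of_surjective _ Ideal.Quotient.mk_surjective, ← RingHom.ker_eq_comap_bot,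
    Ideal.mk_ker, sup_eq_left.2 hqp] at this

/-! ### Zariski closed sets -/

lemma algSet_eq_zeroLocus (S : Set (Poly3 K)) : algSet S = zeroLocus K (Ideal.span S) := by
  rw [zeroLocus_span]; rfl

lemma vanishingIdeal_zariskiClosure (S : Set (Fin 3 → K)) :
    vanishingIdeal K (zariskiClosure S) = vanishingIdeal K S :=
  zeroLocus_vanishingIdeal_galoisConnection.u_l_u_eq_u (b := OrderDual.toDual S)

lemma zariskiClosure_zeroLocus (I : Ideal (Poly3 K)) :
    zariskiClosure (zeroLocus K I) = zeroLocus K I :=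
  zeroLocus_vanishingIdeal_galoisConnection.l_u_l_eq_l I

lemma isVariety_zeroLocus [IsAlgClosed K] (q : Ideal (Poly3 K)) [q.IsPrime] :
    IsVariety (zeroLocus K q) :=
  ⟨zariskiClosure_zeroLocus q, by rwa [IsPrime.vanishingIdeal_zeroLocus]⟩

lemma IsVariety.isPrime {D : Set (Fin 3 → K)} (h : IsVariety D) :
    (vanishingIdeal K D).IsPrime := h.2

lemma mem_vanishingIdeal_of_subset_algSet {D : Set (Fin 3 → K)} {S : Set (Poly3 K)}
    (h : D ⊆ algSet S) {p : Poly3 K} (hp : p ∈ S) : p ∈ vanishingIdeal K D :=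
  fun _ hx => h hx p hp

/-- Two equations without common factor and with a common zero define a space curve. -/
lemma isSpaceCurve_algSet_pair [IsAlgClosed K] {f g : Poly3 K} (hf : Irreducible f)
    (hfg : ¬ f ∣ g) (hne : (algSet {f, g}).Nonempty) : IsSpaceCurve (algSet {f, g}) := by
  refine ⟨hne, by rw [algSet_eq_zeroLocus, zariskiClosure_zeroLocus], fun C hC => ?_⟩
  have hI := hC.prop.1.isPrime
  have hfC : f ∈ vanishingIdeal K C := mem_vanishingIdeal_of_subset_algSet hC.prop.2 (by simp)
  have hgC : g ∈ vanishingIdeal K C := mem_vanishingIdeal_of_subset_algSet hC.prop.2 (by simp)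
  refine ringKrullDim_quotient_eq_one hf hfg hfC hgC fun hmax => ?_
  have hspan : Ideal.span {f, g} ≤ vanishingIdeal K C := by
    rw [Ideal.span_le]; rintro p (rfl | rfl) <;> assumption
  obtain ⟨q, hq, hqC⟩ := Ideal.exists_minimalPrimes_le hspan
  have hqp : q.IsPrime := hq.1.1
  have hCq : C ⊆ zeroLocus K q := le_zeroLocus_iff_le_vanishingIdeal.2 hqC
  have hqZ : zeroLocus K q ⊆ algSet {f, g} := by
    rw [algSet_eq_zeroLocus]; exact zeroLocus_anti_mono hq.1.2
  -- Maximality of `C` identifies its ideal with the minimal prime `q`, to which Krull's height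
  -- theorem applies.
  have hEq : C = zeroLocus K q := hCq.antisymm (hC.2 ⟨isVariety_zeroLocus q, hqZ⟩ hCq)
  have hqm : q.IsMaximal := by rwa [hEq, IsPrime.vanishingIdeal_zeroLocus] at hmax
  have h1 := Ideal.height_le_card_of_mem_minimalPrimes_span (by simp) hq
  rw [height_of_isMaximal q hqm] at h1
  have h2 : ({f, g} : Set (Poly3 K)).ncard ≤ 2 := Set.ncard_insert_le _ _ |>.trans (by simp)
  have h3 : 3 ≤ ({f, g} : Set (Poly3 K)).ncard := by exact_mod_cast h1
  omega

/-- A variety in `{f = g = 0}` that is not a point is a component. -/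
lemma isComponent_algSet_pair {f g : Poly3 K} (hf : Irreducible f)
    (hfg : ¬ f ∣ g) {C : Set (Fin 3 → K)} (hC : IsVariety C) (hCZ : C ⊆ algSet {f, g})
    (hm : ¬ (vanishingIdeal K C).IsMaximal) : IsComponent C (algSet {f, g}) := by
  refine ⟨⟨hC, hCZ⟩, fun D hD hCD => ?_⟩
  have := hC.isPrime
  have := hD.1.isPrime
  have h := eq_of_le_of_not_isMaximal hf hfg
    (mem_vanishingIdeal_of_subset_algSet hD.2 (by simp))
    (mem_vanishingIdeal_of_subset_algSet hD.2 (by simp)) (vanishingIdeal_anti_mono hCD) hm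
  rw [← hC.1, ← hD.1.1, zariskiClosure, h, zariskiClosure]

/-! ### Values of rational triples -/

lemma denom_eval_add {r s : RatFunc K} {t : K} (hr : r.denom.eval t ≠ 0)
    (hs : s.denom.eval t ≠ 0) : (r + s).denom.eval t ≠ 0 := by
  intro h
  have := Polynomial.eval_eq_zero_of_dvd_of_eval_eq_zero (RatFunc.denom_add_dvd r s) h
  rw [Polynomial.eval_mul] at this
  exact mul_ne_zero hr hs this

lemma denom_eval_mul {r s : RatFunc K} {t : K} (hr : r.denom.eval t ≠ 0)
    (hs : s.denom.eval t ≠ 0) : (r * s).denom.eval t ≠ 0 := by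
  intro h
  have := Polynomial.eval_eq_zero_of_dvd_of_eval_eq_zero (RatFunc.denom_mul_dvd r s) h
  rw [Polynomial.eval_mul] at this
  exact mul_ne_zero hr hs this

/-- `RatFunc.eval` respects sums and products only where denominators are nonzero, so regularity is
carried through the induction. -/
lemma denom_eval_and_eval_aeval {P : RatTriple K} {t : K} (h : DefinedAt P t) (p : Poly3 K) :
    (aeval P p).denom.eval t ≠ 0 ∧
      (aeval P p).eval (RingHom.id K) t = eval (valueAt P t) p := by
  induction p using MvPolynomial.induction_on with
  | C c => simp [RatFunc.algebraMap_eq_C]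
  | add p q hp hq =>
    rw [map_add, map_add, RatFunc.eval_add (RingHom.id K) t hp.1 hq.1, hp.2, hq.2]
    exact ⟨denom_eval_add hp.1 hq.1, rfl⟩
  | mul_X p i hp =>
    rw [map_mul, map_mul, aeval_X, eval_X, RatFunc.eval_mul (RingHom.id K) t hp.1 (h i), hp.2]
    exact ⟨denom_eval_mul hp.1 (h i), rfl⟩

/-- The set of values of a rational triple. -/
def values (P : RatTriple K) : Set (Fin 3 → K) := {x | ∃ t, DefinedAt P t ∧ x = valueAt P t}

lemma prod_denom_ne_zero (P : RatTriple K) : ∏ i, (P i).denom ≠ 0 :=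
  Finset.prod_ne_zero_iff.2 fun i _ => (P i).denom_ne_zero

lemma definedAt_iff (P : RatTriple K) (t : K) :
    DefinedAt P t ↔ (∏ i, (P i).denom).eval t ≠ 0 := by
  rw [Polynomial.eval_prod, Finset.prod_ne_zero_iff]; simp [DefinedAt]

lemma exists_definedAt [Infinite K] (P : RatTriple K) : ∃ t, DefinedAt P t := by
  simp_rw [definedAt_iff]
  by_contra! h
  exact prod_denom_ne_zero P (Polynomial.funext fun t => by simpa using h t)

/-- A polynomial vanishes on the values of `P` if and only if it vanishes at `P`. -/
lemma vanishingIdeal_values [Infinite K] (P : RatTriple K) :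
    vanishingIdeal K (values P) = RingHom.ker (aeval P : Poly3 K →ₐ[K] RatFunc K) := by
  ext p
  rw [RingHom.mem_ker, mem_vanishingIdeal_iff]
  constructor
  · intro h
    -- The product of denominators takes care of the points where `P` is undefined.
    have h0 : (aeval P p).num * ∏ i, (P i).denom = 0 := by
      refine Polynomial.funext fun t => ?_
      rw [Polynomial.eval_mul, Polynomial.eval_zero]
      by_cases ht : DefinedAt P t
      · obtain ⟨h1, h2⟩ := denom_eval_and_eval_aeval ht p
        have h3 := h _ ⟨t, ht, rfl⟩
        rw [aeval_eq_eval] at h3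
        have h3' : eval (valueAt P t) p = 0 := h3
        rw [h3', RatFunc.eval, Polynomial.eval₂_id, Polynomial.eval₂_id,
          div_eq_zero_iff] at h2
        rw [h2.resolve_right h1, zero_mul]
      · rw [definedAt_iff, not_not] at ht
        rw [ht, mul_zero]
    exact RatFunc.num_eq_zero_iff.1 ((mul_eq_zero.1 h0).resolve_right (prod_denom_ne_zero P))
  · rintro h x ⟨t, ht, rfl⟩
    have := (denom_eval_and_eval_aeval ht p).2
    rw [h, RatFunc.eval_zero] at this
    exact this.symm

/-- A maximal kernel would be the ideal of a point `x`; containing each `X i - C (x i)`, it would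
make `P` constant. -/
lemma not_isMaximal_ker_aeval [IsAlgClosed K] {P : RatTriple K} (hP : Nonconstant P) :
    ¬ (RingHom.ker (aeval P : Poly3 K →ₐ[K] RatFunc K)).IsMaximal := by
  intro h
  obtain ⟨x, hx⟩ := eq_vanishingIdeal_singleton_of_isMaximal K h
  refine hP x (funext fun i => ?_)
  have : (X i - C (x i) : Poly3 K) ∈ vanishingIdeal K {x} := by
    rw [mem_vanishingIdeal_singleton_iff]; simp
  rw [← hx, RingHom.mem_ker] at this
  simpa [sub_eq_zero, RatFunc.algebraMap_eq_C, constTriple] using this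

/-! ### Adding a constant -/

lemma denom_eval_C (c t : K) : (RatFunc.C c).denom.eval t ≠ 0 := by simp

lemma definedAt_add_constTriple (P : RatTriple K) (v : Fin 3 → K) (t : K) :
    DefinedAt (P + constTriple v) t ↔ DefinedAt P t := by
  refine ⟨fun h i => ?_, fun h i => denom_eval_add (h i) (denom_eval_C _ _)⟩
  have := denom_eval_add (h i) (denom_eval_C (-v i) t)
  simpa [constTriple] using this

lemma valueAt_add_constTriple {P : RatTriple K} {t : K} (h : DefinedAt P t) (v : Fin 3 → K) :
    valueAt (P + constTriple v) t = valueAt P t + v := by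
  funext i
  change RatFunc.eval _ t (P i + RatFunc.C (v i)) = _
  rw [RatFunc.eval_add (RingHom.id K) t (h i) (denom_eval_C _ _)]
  simp [valueAt]

lemma constTriple_neg (v : Fin 3 → K) : constTriple (-v) = -constTriple v := by
  funext i; simp [constTriple]

lemma constTriple_sub (v w : Fin 3 → K) : constTriple (v - w) = constTriple v - constTriple w := by
  funext i; simp [constTriple]

lemma Nonconstant.add_constTriple {P : RatTriple K} (h : Nonconstant P) (v : Fin 3 → K) :
    Nonconstant (P + constTriple v) := fun w hw => h (w - v) (by
  rw [constTriple_sub, ← hw, add_sub_cancel_right])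

lemma aeval_add_constTriple_translate (P : RatTriple K) (v : Fin 3 → K) (p : Poly3 K) :
    aeval (P + constTriple v) (translate (-v) p) = aeval P p := by
  change ((aeval (P + constTriple v)).comp (translate (-v)).toAlgHom) p = _
  congr 1
  ext i
  simp [translate_apply, constTriple, RatFunc.algebraMap_eq_C]

lemma Proper.add_constTriple {P : RatTriple K} (h : Proper P) (v : Fin 3 → K) :
    Proper (P + constTriple v) := by
  obtain ⟨A, B, hB, hAB⟩ := h
  refine ⟨translate (-v) A, translate (-v) B, ?_, ?_⟩
  · rwa [aeval_add_constTriple_translate]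
  · rwa [aeval_add_constTriple_translate, aeval_add_constTriple_translate]

lemma SumParametrizes.add_constTriple {P₁ P₂ : RatTriple K} {V : Set (Fin 3 → K)}
    (h : SumParametrizes P₁ P₂ V) (v : Fin 3 → K) :
    SumParametrizes (P₁ + constTriple v) (P₂ + constTriple (-v)) V := by
  refine ⟨h.1.add_constTriple v, h.2.1.add_constTriple _, ?_⟩
  rw [← h.2.2]
  congr 1
  ext x
  simp only [Set.mem_ofPred_eq, definedAt_add_constTriple]
  refine exists_congr fun s => exists_congr fun t => and_congr_right fun hs =>
    and_congr_right fun ht => ?_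
  rw [valueAt_add_constTriple hs, valueAt_add_constTriple ht, add_add_add_comm, add_neg_cancel,
    add_zero]

/-! ### First order expansions of rational functions -/

/-- The rational function `r` is regular at `t` and equals `z` to first order there. -/
def HasJet (t : K) (r : RatFunc K) (z : DualNumber K) : Prop :=
  ∃ n d : Polynomial K, d.eval t ≠ 0 ∧
    r * algebraMap (Polynomial K) (RatFunc K) d = algebraMap (Polynomial K) (RatFunc K) n ∧
    z * Polynomial.aeval (TrivSqZeroExt.inl t + TrivSqZeroExt.inr 1 : DualNumber K) d =
      Polynomial.aeval (TrivSqZeroExt.inl t + TrivSqZeroExt.inr 1 : DualNumber K) n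

lemma aeval_jet (p : Polynomial K) (t : K) :
    Polynomial.aeval (TrivSqZeroExt.inl t + TrivSqZeroExt.inr 1 : DualNumber K) p =
      TrivSqZeroExt.inl (p.eval t) + TrivSqZeroExt.inr (p.derivative.eval t) := by
  induction p using Polynomial.induction_on' with
  | add p q hp hq => rw [map_add, hp, hq]; ext <;> simp
  | monomial n c =>
    rw [Polynomial.aeval_monomial, TrivSqZeroExt.algebraMap_eq_inl]
    ext <;> simp [TrivSqZeroExt.fst_pow, TrivSqZeroExt.snd_pow, Polynomial.derivative_monomial]
    ring

lemma HasJet.const (t c : K) : HasJet t (RatFunc.C c) (algebraMap K (DualNumber K) c) :=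
  ⟨Polynomial.C c, 1, by simp, by simp, by simp⟩

lemma HasJet.add {t : K} {r s : RatFunc K} {z w : DualNumber K} (hr : HasJet t r z)
    (hs : HasJet t s w) : HasJet t (r + s) (z + w) := by
  obtain ⟨n, d, hd, h1, h2⟩ := hr
  obtain ⟨m, e, he, h3, h4⟩ := hs
  refine ⟨n * e + m * d, d * e, by simp [hd, he], ?_, ?_⟩
  · simp only [map_mul, map_add, ← h1, ← h3]; ring
  · simp only [map_mul, map_add, ← h2, ← h4]; ring

lemma HasJet.mul {t : K} {r s : RatFunc K} {z w : DualNumber K} (hr : HasJet t r z)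
    (hs : HasJet t s w) : HasJet t (r * s) (z * w) := by
  obtain ⟨n, d, hd, h1, h2⟩ := hr
  obtain ⟨m, e, he, h3, h4⟩ := hs
  refine ⟨n * m, d * e, by simp [hd, he], ?_, ?_⟩
  · simp only [map_mul, ← h1, ← h3]; ring
  · simp only [map_mul, ← h2, ← h4]; ring

/-- The numerator is zero, and the denominator at `t + ε` is a unit, its constant part being
nonzero. -/
lemma HasJet.eq_zero {t : K} {z : DualNumber K} (h : HasJet t 0 z) : z = 0 := by
  obtain ⟨n, d, hd, h1, h2⟩ := h
  rw [zero_mul, eq_comm, map_eq_zero_iff _ (RatFunc.algebraMap_injective K)] at h1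
  rw [h1, map_zero, aeval_jet] at h2
  refine (IsUnit.mul_left_eq_zero ?_).1 h2
  rw [TrivSqZeroExt.isUnit_iff_isUnit_fst]
  simpa using hd

lemma HasJet.aeval {t : K} {P : RatTriple K} {z : Fin 3 → DualNumber K}
    (h : ∀ i, HasJet t (P i) (z i)) (p : Poly3 K) :
    HasJet t (MvPolynomial.aeval P p) (MvPolynomial.aeval z p) := by
  induction p using MvPolynomial.induction_on with
  | C c => simpa [RatFunc.algebraMap_eq_C] using HasJet.const t c
  | add p q hp hq => simpa using hp.add hq
  | mul_X p i hp => simpa using hp.mul (h i)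

/-- The quotient-rule fraction need not be reduced, while `RatFunc.eval` uses the reduced one;
cross-multiplication compares them. -/
lemma eval_ratDeriv {r : RatFunc K} {t : K} (h : r.denom.eval t ≠ 0) :
    (ratDeriv r).eval (RingHom.id K) t =
      (r.num.derivative.eval t * r.denom.eval t - r.num.eval t * r.denom.derivative.eval t) /
        r.denom.eval t ^ 2 := by
  have hd : r.denom ^ 2 ≠ 0 := pow_ne_zero _ r.denom_ne_zero
  have h1 := (RatFunc.num_mul_eq_mul_denom_iff (x := ratDeriv r) hd).2 rfl
  have h2 : (ratDeriv r).denom.eval t ≠ 0 := fun h0 => by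
    have := Polynomial.eval_eq_zero_of_dvd_of_eval_eq_zero (RatFunc.denom_div_dvd _ _) h0
    rw [Polynomial.eval_pow] at this
    exact pow_ne_zero 2 h this
  have h3 := congrArg (Polynomial.eval t) h1
  simp only [Polynomial.eval_mul, Polynomial.eval_pow, Polynomial.eval_sub] at h3
  rw [RatFunc.eval, Polynomial.eval₂_id, Polynomial.eval₂_id, div_eq_div_iff h2 (pow_ne_zero 2 h),
    h3]

lemma hasJet_of_denom_ne_zero {r : RatFunc K} {t : K} (h : r.denom.eval t ≠ 0) :
    HasJet t r (TrivSqZeroExt.inl (r.eval (RingHom.id K) t) +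
      TrivSqZeroExt.inr ((ratDeriv r).eval (RingHom.id K) t)) := by
  refine ⟨r.num, r.denom, h, ?_, ?_⟩
  · nth_rw 1 [← RatFunc.num_div_denom r]
    exact div_mul_cancel₀ _ (RatFunc.algebraMap_ne_zero r.denom_ne_zero)
  · rw [eval_ratDeriv h, aeval_jet, aeval_jet, RatFunc.eval, Polynomial.eval₂_id,
      Polynomial.eval₂_id]
    ext
    · simp [h]
    · simp; field_simp; ring

/-- If `f` vanishes along `P + v`, then `∇f · P'(t)` vanishes at `P(t) + v`. -/
lemma eval_gradDot_eq_zero {P : RatTriple K} {f : Poly3 K} {v : Fin 3 → K}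
    (hf : aeval (P + constTriple v) f = 0) {t : K} (ht : DefinedAt P t) :
    eval (valueAt P t + v) (gradDot f (valueAt (derivTriple P) t)) = 0 := by
  have h := HasJet.aeval (P := P + constTriple v)
    (fun i => (hasJet_of_denom_ne_zero (ht i)).add (HasJet.const t (v i))) f
  rw [hf] at h
  have h1 := h.eq_zero
  have h2 := aeval_dual f (valueAt P t + v) (valueAt (derivTriple P) t)
  have h3 : (fun i => (TrivSqZeroExt.inl ((valueAt P t + v) i) +
      TrivSqZeroExt.inr (valueAt (derivTriple P) t i) : DualNumber K)) =
      fun i => TrivSqZeroExt.inl ((P i).eval (RingHom.id K) t) +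
        TrivSqZeroExt.inr ((ratDeriv (P i)).eval (RingHom.id K) t) +
          algebraMap K (DualNumber K) (v i) := by
    funext i
    ext <;> simp [valueAt, derivTriple, TrivSqZeroExt.algebraMap_eq_inl]
  -- The jet of `f(P + v) = 0` is zero; its `ε`-part is the directional derivative.
  rw [h3, h1] at h2
  simpa using (congrArg TrivSqZeroExt.snd h2).symm

/-! ### Translational surfaces -/

/-- `f` vanishes at `P₁(s) + P₂(t)`, hence at `P₂ + P₁(s)` as a triple of rational functions. -/
lemma SumParametrizes.aeval_eq_zero [Infinite K] {f : Poly3 K} {P₁ P₂ : RatTriple K}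
    (h : SumParametrizes P₁ P₂ (algSet {f})) {s : K} (hs : DefinedAt P₁ s) :
    aeval (P₂ + constTriple (valueAt P₁ s)) f = 0 := by
  -- With `s` frozen, vanishing at all values in `t` gives an identity in `K(t)`, which can be
  -- differentiated.
  rw [← RingHom.mem_ker (f := aeval (P₂ + constTriple (valueAt P₁ s))), ← vanishingIdeal_values]
  rintro x ⟨t, ht, rfl⟩
  rw [definedAt_add_constTriple] at ht
  have hx : valueAt P₁ s + valueAt P₂ t ∈ algSet {f} :=
    h.2.2 ▸ zeroLocus_vanishingIdeal_le _ ⟨s, t, hs, ht, rfl⟩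
  rw [valueAt_add_constTriple ht, add_comm, aeval_eq_eval]
  exact hx f rfl

/-- The values of `P₁ + P₂(t₀)` lie on the curve `f = g = 0`. -/
lemma SumParametrizes.values_subset [Infinite K] {f : Poly3 K} {P₁ P₂ : RatTriple K}
    (h : SumParametrizes P₁ P₂ (algSet {f})) {t₀ : K} (ht₀ : DefinedAt P₂ t₀) :
    values (P₁ + constTriple (valueAt P₂ t₀)) ⊆
      algSet {f, gradDot f (valueAt (derivTriple P₂) t₀)} := by
  rintro x ⟨s, hs, rfl⟩
  rw [definedAt_add_constTriple] at hs
  rw [valueAt_add_constTriple hs]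
  have h0 := h.aeval_eq_zero hs
  rintro p (rfl | rfl)
  · have := (denom_eval_and_eval_aeval
      ((definedAt_add_constTriple P₂ (valueAt P₁ s) t₀).2 ht₀) p).2
    rw [h0, RatFunc.eval_zero, valueAt_add_constTriple ht₀, add_comm] at this
    exact this.symm
  · have := eval_gradDot_eq_zero h0 ht₀
    rwa [add_comm] at this

end Translational

end

theorem corollary1 {K : Type*} [Field K] [IsAlgClosed K] [CharZero K]
    (f : Translational.Poly3 K) (hf : Irreducible f)
    (hcyl : ¬ Translational.IsCylindrical (Translational.algSet {f}))
    (P₁ P₂ : Translational.RatTriple K)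
    (hP : Translational.SumParametrizes P₁ P₂ (Translational.algSet {f}))
    (hP₁ : Translational.Proper P₁) (hP₂ : Translational.Proper P₂)
    (t₀ : K) (ht₀ : Translational.DefinedAt P₂ t₀)
    (a : Fin 3 → K) (ha : Translational.valueAt (Translational.derivTriple P₂) t₀ = a)
    (ha₀ : a ≠ 0) :
    (Translational.IsSpaceCurve (Translational.algSet {f, Translational.gradDot f a}) ∧
      ∃ C : Set (Fin 3 → K),
        Translational.IsComponent C (Translational.algSet {f, Translational.gradDot f a}) ∧
        Translational.ParametrizesCurve
          (P₁ + Translational.constTriple (Translational.valueAt P₂ t₀)) C ∧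
        Translational.Proper
          (P₁ + Translational.constTriple (Translational.valueAt P₂ t₀))) ∧
    (Translational.SumParametrizes
        (P₁ + Translational.constTriple (Translational.valueAt P₂ t₀))
        (P₂ - Translational.constTriple (Translational.valueAt P₂ t₀))
        (Translational.algSet {f}) ∧
      Translational.Proper (P₂ - Translational.constTriple (Translational.valueAt P₂ t₀))) := by
  subst ha
  have hdvd := Translational.not_dvd_gradDot hf hcyl ha₀
  have hsub := hP.values_subset ht₀
  set v := Translational.valueAt P₂ t₀
  have hnc := hP.1.add_constTriple v
  have hker := Translational.vanishingIdeal_values (P₁ + Translational.constTriple v)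
  have hprime : (MvPolynomial.vanishingIdeal K (Translational.values (P₁ + Translational.constTriple v))).IsPrime :=
    hker ▸ RingHom.ker_isPrime _
  have hI := Translational.vanishingIdeal_zariskiClosure (Translational.values (P₁ + Translational.constTriple v))
  have hclosure : Translational.zariskiClosure (Translational.values (P₁ + Translational.constTriple v)) ⊆
      Translational.algSet {f, Translational.gradDot f (Translational.valueAt (Translational.derivTriple P₂) t₀)} := by
    rw [Translational.algSet_eq_zeroLocus] at hsub ⊢
    exact MvPolynomial.zeroLocus_anti_mono (MvPolynomial.le_zeroLocus_iff_le_vanishingIdeal.1 hsub)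
  have hneg : P₂ - Translational.constTriple v = P₂ + Translational.constTriple (-v) := by
    rw [Translational.constTriple_neg, sub_eq_add_neg]
  obtain ⟨s, hs⟩ := Translational.exists_definedAt (P₁ + Translational.constTriple v)
  rw [hneg]
  refine ⟨⟨Translational.isSpaceCurve_algSet_pair hf hdvd ⟨_, hsub ⟨s, hs, rfl⟩⟩,
    Translational.zariskiClosure (Translational.values (P₁ + Translational.constTriple v)), ?_, ⟨hnc, rfl⟩, hP₁.add_constTriple v⟩,
    hP.add_constTriple v, hP₂.add_constTriple _⟩
  refine Translational.isComponent_algSet_pair hf hdvd ⟨Translational.zariskiClosure_zeroLocus _, hI ▸ hprime⟩ hclosure ?_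
  rw [hI, hker]
  exact Translational.not_isMaximal_ker_aeval hnc
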